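/- Let $\mathcal{L}(\Rightarrow)$ be the language $\varphi ::= p \mid \neg\varphi \mid (\varphi\wedge\varphi) \mid \Box\varphi \mid (\varphi\Rightarrow\varphi)$, with $p$ ranging over a fixed set of propositional variables; $\vee,\to,\leftrightarrow$ are defined as usual and $\Diamond\varphi := \neg\Box\neg\varphi$. A formula is nonmodal if it contains neither $\Box$ nor $\Rightarrow$. A model is a pair $\mathcal{M}=\langle W,V\rangle$ with $W$ a nonempty set and $V(p)\subseteq W$ for each variable $p$. Truth at $w\in W$ relative to an information state $X\subseteq W$ (possibly empty, and possibly not containing $w$) is defined by: $\mathcal{M},w,X\vDash p$ iff $w\in V(p)$; $\neg$ and $\wedge$ are interpreted classically; $\mathcal{M},w,X\vDash\Box\varphi$ iff $\mathcal{M},v,X\vDash\varphi$ for all $v\in X$; and $\mathcal{M},w,X\vDash\varphi\Rightarrow\psi$ iff $\mathcal{M},v,Y\vDash\psi$ for all $v\in Y$, where $Y=\{v\in X\mid \mathcal{M},v,X\vDash\varphi\}$. A formula is valid iff it is true at every world relative to every information state in every model. A formula $\varphi$ is an informational consequence of a set $\Sigma$ of formulas iff for every model and every information state $X$: if for every $\sigma\in\Sigma$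 and every $w\in X$ we have $\mathcal{M},w,X\vDash\sigma$, then $\mathcal{M},w,X\vDash\varphi$ for every $w\in X$. The Yalcin logic is the smallest set of formulas that contains all substitution instances of propositional tautologies and all instances of the axioms - K: $\Box(\varphi\to\psi)\to(\Box\varphi\to\Box\psi)$ - 4: $\Diamond\Diamond\varphi\to\Diamond\varphi$ - 5: $\Diamond\Box\varphi\to\Box\varphi$ - I1: $(\varphi\Rightarrow\pi)\leftrightarrow\Box(\varphi\to\pi)$ for $\pi$ nonmodal - I2: $(\varphi\Rightarrow(\alpha\wedge\beta))\leftrightarrow((\varphi\Rightarrow\alpha)\wedge(\varphi\Rightarrow\beta))$ - I3: $(\varphi\Rightarrow\alpha)\to(\varphi\Rightarrow(\alpha\vee\beta))$ - I4: $(\varphi\Rightarrow\alpha)\to(\varphi\Rightarrow\Box\alpha)$ - I5: $((\varphi\Rightarrow(\alpha\vee\Box\beta))\wedge\neg(\varphi\Rightarrow\beta))\to(\varphi\Rightarrow\alpha)$ - I6: $((\varphi\Rightarrow(\alpha\vee\Diamond\beta))\wedge(\varphi\Rightarrow\neg\beta))\to(\varphi\Rightarrow\alpha)$ - I7: $\neg(\varphi\Rightarrow\beta)\to(\varphi\Rightarrow\Diamond\neg\beta)$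 and is closed under modus ponens for $\to$, necessitation for $\Box$ (from $\varphi$ infer $\Box\varphi$), and replacement of equivalents (if $\alpha\leftrightarrow\beta$ is in the set and $\varphi'$ is obtained from $\varphi$ by replacing some occurrence of $\alpha$ in $\varphi$ by $\beta$, then $\varphi\leftrightarrow\varphi'$ is in the set). **Theorem.** The set of valid formulas of $\mathcal{L}(\Rightarrow)$ is the Yalcin logic. Moreover, for all formulas $\varphi,\sigma_1,\dots,\sigma_n$ ($n\ge 0$), $\varphi$ is an informational consequence of $\{\sigma_1,\dots,\sigma_n\}$ iff $(\Box\sigma_1\wedge\dots\wedge\Box\sigma_n)\to\Box\varphi$ is a theorem of the Yalcin logic (for $n=0$ this formula is read as $\Box\varphi$). -/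

import Mathlib

universe u w

namespace Yalcin

/-- Formulas of the language with `¬`, `∧`, the epistemic modal `□` ("must") and the indicative
conditional `⇒`, over a set `Var` of propositional variables. -/
inductive Form (Var : Type u) : Type u
  | var (p : Var) : Form Var
  | neg (φ : Form Var) : Form Var
  | and (φ ψ : Form Var) : Form Var
  | box (φ : Form Var) : Form Var
  | cond (φ ψ : Form Var) : Form Var

namespace Form

variable {Var : Type u}

/-- Disjunction, a defined connective. -/
def or (φ ψ : Form Var) : Form Var := neg (and (neg φ) (neg ψ))

/-- The material conditional, a defined connective. -/
def imp (φ ψ : Form Var) : Form Var := neg (and φ (neg ψ))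

/-- The material biconditional, a defined connective. -/
def iff (φ ψ : Form Var) : Form Var := and (imp φ ψ) (imp ψ φ)

/-- "Might", the dual of `□`. -/
def dia (φ : Form Var) : Form Var := neg (box (neg φ))

/-- A formula is nonmodal if it contains neither `□` nor `⇒`. -/
def Nonmodal : Form Var → Prop
  | var _ => True
  | neg φ => Nonmodal φ
  | and φ ψ => Nonmodal φ ∧ Nonmodal ψ
  | box _ => False
  | cond _ _ => False

/-- `conjBoxes σ [τ₁, …, τₖ]` is `□σ ∧ (□τ₁ ∧ (… ∧ □τₖ))`. -/
def conjBoxes : Form Var → List (Form Var) → Form Var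
  | σ, [] => box σ
  | σ, τ :: l => and (box σ) (conjBoxes τ l)

/-- The formula `(□σ₁ ∧ … ∧ □σₙ) → □φ`. When there are no premises the antecedent is the empty
conjunction, and the formula is `□φ`. -/
def boxedImp : List (Form Var) → Form Var → Form Var
  | [], φ => box φ
  | σ :: l, φ => imp (conjBoxes σ l) (box φ)

end Form

/-! ### Domain semantics -/

/-- A model: a nonempty set of worlds with a proposition for every propositional variable. -/
structure Model (Var : Type u) where
  W : Type w
  nonempty : Nonempty W
  V : Var → Set W

section Semantics

variable {Var : Type u}

/-- Truth of a formula at the world `x` relative to the information state `X`. The world `x` need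
not belong to `X`, and `X` may be empty. -/
def Sat (M : Model.{u, w} Var) : M.W → Set M.W → Form Var → Prop
  | x, _, .var p => x ∈ M.V p
  | x, X, .neg φ => ¬ Sat M x X φ
  | x, X, .and φ ψ => Sat M x X φ ∧ Sat M x X ψ
  | _, X, .box φ => ∀ v ∈ X, Sat M v X φ
  | _, X, .cond φ ψ =>
      ∀ v ∈ {v | v ∈ X ∧ Sat M v X φ}, Sat M v {v | v ∈ X ∧ Sat M v X φ} ψ

/-- Truth at every world relative to every information state in every model. -/
def Valid (φ : Form Var) : Prop :=
  ∀ (M : Model.{u, w} Var) (x : M.W) (X : Set M.W), Sat M x X φ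

/-- The information state `X` accepts `φ`. -/
def Accepts (M : Model.{u, w} Var) (X : Set M.W) (φ : Form Var) : Prop :=
  ∀ x ∈ X, Sat M x X φ

/-- `φ` is an informational consequence of the set `S` of formulas. -/
def InfConsequence (S : Set (Form Var)) (φ : Form Var) : Prop :=
  ∀ (M : Model.{u, w} Var) (X : Set M.W), (∀ σ ∈ S, Accepts M X σ) → Accepts M X φ

end Semantics

/-! ### The Yalcin logic -/

/-- Formulas of classical propositional logic, with letters indexed by `ℕ`. -/
inductive PropForm : Type
  | letter (n : ℕ) : PropForm
  | neg (τ : PropForm) : PropForm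
  | and (τ τ' : PropForm) : PropForm

namespace PropForm

/-- Truth of a propositional formula under an assignment. -/
def Eval (a : ℕ → Prop) : PropForm → Prop
  | letter n => a n
  | neg τ => ¬ Eval a τ
  | and τ τ' => Eval a τ ∧ Eval a τ'

/-- Propositional tautologies. -/
def Tautology (τ : PropForm) : Prop := ∀ a : ℕ → Prop, Eval a τ

/-- Uniform substitution of formulas for the propositional letters. -/
def subst {Var : Type u} (s : ℕ → Form Var) : PropForm → Form Var
  | letter n => s n
  | neg τ => .neg (subst s τ)
  | and τ τ' => .and (subst s τ) (subst s τ')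

end PropForm

section Logic

variable {Var : Type u}

/-- `Replace α β φ φ'`: the formula `φ'` is obtained from `φ` by replacing one occurrence of `α`
in `φ` by `β`. -/
inductive Replace (α β : Form Var) : Form Var → Form Var → Prop
  | here : Replace α β α β
  | neg {φ φ' : Form Var} : Replace α β φ φ' → Replace α β (.neg φ) (.neg φ')
  | and_left {φ φ' : Form Var} (ψ : Form Var) :
      Replace α β φ φ' → Replace α β (.and φ ψ) (.and φ' ψ)
  | and_right {φ φ' : Form Var} (ψ : Form Var) :
      Replace α β φ φ' → Replace α β (.and ψ φ) (.and ψ φ')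
  | box {φ φ' : Form Var} : Replace α β φ φ' → Replace α β (.box φ) (.box φ')
  | cond_left {φ φ' : Form Var} (ψ : Form Var) :
      Replace α β φ φ' → Replace α β (.cond φ ψ) (.cond φ' ψ)
  | cond_right {φ φ' : Form Var} (ψ : Form Var) :
      Replace α β φ φ' → Replace α β (.cond ψ φ) (.cond ψ φ')

/-- Theoremhood in the Yalcin logic: the smallest set of formulas that contains all substitution instances of
propositional tautologies and all instances of the axioms K, 4, 5, I1, …, I7, and is closed under
modus ponens, necessitation and replacement of equivalents. -/
inductive YalcinLogic : Form Var → Prop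
  | taut (τ : PropForm) (s : ℕ → Form Var) : τ.Tautology → YalcinLogic (τ.subst s)
  | axK (φ ψ : Form Var) :
      YalcinLogic (.imp (.box (.imp φ ψ)) (.imp (.box φ) (.box ψ)))
  | ax4 (φ : Form Var) : YalcinLogic (.imp (.dia (.dia φ)) (.dia φ))
  | ax5 (φ : Form Var) : YalcinLogic (.imp (.dia (.box φ)) (.box φ))
  | axI1 (φ π : Form Var) : π.Nonmodal →
      YalcinLogic (.iff (.cond φ π) (.box (.imp φ π)))
  | axI2 (φ α β : Form Var) :
      YalcinLogic (.iff (.cond φ (.and α β)) (.and (.cond φ α) (.cond φ β)))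
  | axI3 (φ α β : Form Var) :
      YalcinLogic (.imp (.cond φ α) (.cond φ (.or α β)))
  | axI4 (φ α : Form Var) : YalcinLogic (.imp (.cond φ α) (.cond φ (.box α)))
  | axI5 (φ α β : Form Var) :
      YalcinLogic
        (.imp (.and (.cond φ (.or α (.box β))) (.neg (.cond φ β))) (.cond φ α))
  | axI6 (φ α β : Form Var) :
      YalcinLogic
        (.imp (.and (.cond φ (.or α (.dia β))) (.cond φ (.neg β))) (.cond φ α))
  | axI7 (φ β : Form Var) :
      YalcinLogic (.imp (.neg (.cond φ β)) (.cond φ (.dia (.neg β))))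
  | mp {φ ψ : Form Var} : YalcinLogic (.imp φ ψ) → YalcinLogic φ → YalcinLogic ψ
  | nec {φ : Form Var} : YalcinLogic φ → YalcinLogic (.box φ)
  | repl {α β φ φ' : Form Var} :
      YalcinLogic (.iff α β) → Replace α β φ φ' → YalcinLogic (.iff φ φ')

end Logic

end Yalcin

/-! Soundness is an induction on derivations. For completeness, a non-theorem fails under some
canonical valuation `f`, and `f` is turned into a pointed finite model. The worlds are the
assignments to the variables of the formula. Each world has a nonmodal description, so `f`
determines both a world and an information state, namely the worlds whose description `f` deems
possible. The truth lemma `sat_finModel_iff` is an induction whose hard case is `φ ⇒ ψ`. By I2 and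
replacement, `φ ⇒ ·` behaves like a normal box (`cond_iff`). By I1 the worlds surviving the
supposition of `φ` can be read off from `f`. By I4 and I7 each valuation verifying everything `f`
accepts under `φ` describes exactly that restricted state (`stateOf_cond`). Axioms I3, I5 and I6 are
needed only for soundness. -/

namespace Yalcin

variable {Var : Type u}

/-! ### Soundness -/

section Soundness

variable (M : Model.{u, w} Var) (x : M.W) (X : Set M.W) (φ ψ : Form Var)

theorem sat_neg : Sat M x X φ.neg ↔ ¬ Sat M x X φ := Iff.rfl

theorem sat_and : Sat M x X (φ.and ψ) ↔ Sat M x X φ ∧ Sat M x X ψ := Iff.rfl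

theorem sat_box : Sat M x X φ.box ↔ ∀ v ∈ X, Sat M v X φ := Iff.rfl

theorem sat_cond : Sat M x X (φ.cond ψ) ↔
    ∀ v ∈ {v | v ∈ X ∧ Sat M v X φ}, Sat M v {v | v ∈ X ∧ Sat M v X φ} ψ := Iff.rfl

theorem sat_or : Sat M x X (φ.or ψ) ↔ Sat M x X φ ∨ Sat M x X ψ := by
  simp only [Form.or, sat_neg, sat_and]; tauto

theorem sat_imp : Sat M x X (φ.imp ψ) ↔ (Sat M x X φ → Sat M x X ψ) := by
  simp only [Form.imp, sat_neg, sat_and]; tauto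

theorem sat_iff : Sat M x X (φ.iff ψ) ↔ (Sat M x X φ ↔ Sat M x X ψ) := by
  simp only [Form.iff, sat_imp, sat_and]; tauto

theorem sat_dia : Sat M x X φ.dia ↔ ∃ v ∈ X, Sat M v X φ := by
  simp [Form.dia, sat_neg, sat_box]

theorem sat_subst (s : ℕ → Form Var) (τ : PropForm) :
    Sat M x X (τ.subst s) ↔ τ.Eval fun n => Sat M x X (s n) := by
  induction τ with
  | letter n => rfl
  | neg τ ih => exact not_congr ih
  | and τ τ' ih ih' => exact and_congr ih ih'

variable {M φ}

/-- The truth of a nonmodal formula does not depend on the information state. -/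
theorem Form.Nonmodal.sat_congr (h : φ.Nonmodal) (X Y : Set M.W) :
    Sat M x X φ ↔ Sat M x Y φ := by
  induction φ with
  | var p => rfl
  | neg φ ih => exact not_congr (ih h)
  | and φ ψ ih ih' => exact and_congr (ih h.1) (ih' h.2)
  | box φ => exact h.elim
  | cond φ ψ => exact h.elim

/-- The hypothesis ranges over all worlds and states because `□` shifts the world and the antecedent
of `⇒` shifts the state. -/
theorem Replace.sat_congr {α β φ φ' : Form Var} (hr : Replace α β φ φ')
    (h : ∀ x X, Sat M x X α ↔ Sat M x X β) (x : M.W) (X : Set M.W) :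
    Sat M x X φ ↔ Sat M x X φ' := by
  induction hr generalizing x X with
  | here => exact h x X
  | neg _ ih => exact not_congr (ih x X)
  | and_left ψ _ ih => exact and_congr_left' (ih x X)
  | and_right ψ _ ih => exact and_congr_right' (ih x X)
  | box _ ih => exact forall₂_congr fun v _ => ih v X
  | cond_left ψ _ ih => simp only [sat_cond, ih]
  | cond_right ψ _ ih => exact forall₂_congr fun v _ => ih v _

end Soundness

theorem YalcinLogic.valid {φ : Form Var} (h : YalcinLogic φ) : Valid.{u, w} φ := by
  induction h with
  | taut τ s hτ => exact fun M x X => (sat_subst M x X s τ).2 (hτ _)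
  | axK φ ψ =>
    intro M x X
    simp only [sat_imp, sat_box]
    exact fun h h' v hv => h v hv (h' v hv)
  | ax4 φ =>
    intro M x X
    simp only [sat_imp, sat_dia]
    exact fun ⟨_, _, h⟩ => h
  | ax5 φ =>
    intro M x X
    simp only [sat_imp, sat_dia, sat_box]
    exact fun ⟨_, _, h⟩ => h
  | axI1 φ π hπ =>
    intro M x X
    simp only [sat_iff, sat_imp, sat_cond, sat_box, Set.mem_ofPred_eq, and_imp]
    exact forall₃_congr fun v _ _ => hπ.sat_congr v _ _
  | axI2 φ α β =>
    intro M x X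
    simp only [sat_iff, sat_and, sat_cond]
    exact forall₂_and
  | axI3 φ α β =>
    intro M x X
    simp only [sat_imp, sat_or, sat_cond]
    exact fun h v hv => Or.inl (h v hv)
  | axI4 φ α =>
    intro M x X
    simp only [sat_imp, sat_box, sat_cond]
    exact fun h v hv => h
  | axI5 φ α β =>
    intro M x X
    simp only [sat_imp, sat_and, sat_neg, sat_or, sat_box, sat_cond]
    exact fun h v hv => (h.1 v hv).resolve_right h.2
  | axI6 φ α β =>
    intro M x X
    simp only [sat_imp, sat_and, sat_neg, sat_or, sat_dia, sat_cond]
    exact fun h v hv => (h.1 v hv).resolve_right fun ⟨u, hu, h'⟩ => h.2 u hu h'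
  | axI7 φ β =>
    intro M x X
    simp only [sat_imp, sat_neg, sat_dia, sat_cond, not_forall, exists_prop]
    exact fun h v hv => h
  | mp _ _ ih ih' => exact fun M x X => (sat_imp M x X _ _).1 (ih M x X) (ih' M x X)
  | nec _ ih => exact fun M x X v _ => ih M v X
  | repl _ hr ih =>
    exact fun M x X => (sat_iff M x X _ _).2
      (hr.sat_congr (fun y Y => (sat_iff M y Y _ _).1 (ih M y Y)) x X)

/-! ### Boolean valuations -/

/-- A two-valued assignment to all formulas that respects negation and conjunction. -/
structure IsValuation (f : Form Var → Prop) : Prop where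
  neg (φ : Form Var) : f φ.neg ↔ ¬ f φ
  and (φ ψ : Form Var) : f (φ.and ψ) ↔ f φ ∧ f ψ

theorem IsValuation.imp {f : Form Var → Prop} (hf : IsValuation f) (φ ψ : Form Var) :
    f (φ.imp ψ) ↔ (f φ → f ψ) := by
  simp only [Form.imp, hf.neg, hf.and]; tauto

theorem IsValuation.iff {f : Form Var → Prop} (hf : IsValuation f) (φ ψ : Form Var) :
    f (φ.iff ψ) ↔ (f φ ↔ f ψ) := by
  simp only [Form.iff, hf.imp, hf.and]; tauto

theorem IsValuation.dia {f : Form Var → Prop} (hf : IsValuation f) (φ : Form Var) :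
    f φ.dia ↔ ¬ f φ.neg.box := hf.neg _

theorem IsValuation.foldr_imp {f : Form Var → Prop} (hf : IsValuation f)
    (L : List (Form Var)) (φ : Form Var) :
    f (L.foldr Form.imp φ) ↔ ((∀ γ ∈ L, f γ) → f φ) := by
  induction L with
  | nil => simp
  | cons γ L ih => simp [hf.imp, ih]

namespace Form

/-- The maximal subformulas that are not negations or conjunctions. -/
def atoms : Form Var → List (Form Var)
  | var p => [var p]
  | neg φ => atoms φ
  | and φ ψ => atoms φ ++ atoms ψ
  | box φ => [box φ]
  | cond φ ψ => [cond φ ψ]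

/-- The propositional skeleton of a formula, given a numbering of its atoms. -/
def skeleton (e : Form Var → ℕ) : Form Var → PropForm
  | neg φ => .neg (skeleton e φ)
  | and φ ψ => .and (skeleton e φ) (skeleton e ψ)
  | φ => .letter (e φ)

theorem subst_skeleton (e : Form Var → ℕ) (s : ℕ → Form Var) (φ : Form Var)
    (h : ∀ α ∈ φ.atoms, s (e α) = α) : (φ.skeleton e).subst s = φ := by
  induction φ with
  | var p => exact h _ (by simp [atoms])
  | neg φ ih => simp only [skeleton, PropForm.subst, ih h]
  | and φ ψ ih ih' =>
    simp only [atoms, List.mem_append] at h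
    simp only [skeleton, PropForm.subst, ih fun α hα => h α (Or.inl hα),
      ih' fun α hα => h α (Or.inr hα)]
  | box φ => exact h _ (by simp [atoms])
  | cond φ ψ => exact h _ (by simp [atoms])

end Form

theorem isValuation_eval_skeleton (e : Form Var → ℕ) (a : ℕ → Prop) :
    IsValuation fun φ => (φ.skeleton e).Eval a :=
  ⟨fun _ => Iff.rfl, fun _ _ => Iff.rfl⟩

/-- A formula true under all Boolean valuations is an instance of a tautology. -/
theorem YalcinLogic.of_forall_isValuation {φ : Form Var}
    (h : ∀ f : Form Var → Prop, IsValuation f → f φ) : YalcinLogic φ := by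
  classical
  have hs := Form.subst_skeleton (fun α => φ.atoms.idxOf α) (fun n => φ.atoms.getD n φ) φ
    fun α hα => by
      have := List.idxOf_lt_length_of_mem hα
      simp [List.getD_eq_getElem?_getD, this]
  rw [← hs]
  exact .taut _ _ fun a => h _ (isValuation_eval_skeleton _ a)

open Filter in
/-- Lindenbaum's lemma, for a set of formulas that contains the tautologies and is closed under
modus ponens. -/
theorem exists_isValuation_of_notMem {Γ : Set (Form Var)}
    (taut : ∀ φ, (∀ f : Form Var → Prop, IsValuation f → f φ) → φ ∈ Γ)
    (mp : ∀ φ ψ : Form Var, φ.imp ψ ∈ Γ → φ ∈ Γ → ψ ∈ Γ) {β : Form Var} (hβ : β ∉ Γ) :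
    ∃ f : Form Var → Prop, IsValuation f ∧ (∀ φ ∈ Γ, f φ) ∧ ¬ f β := by
  -- Otherwise an iterated implication from `S` to `β` would be a tautology, and detaching its
  -- antecedents would put `β` in `Γ`.
  have fin (S : Finset Γ) :
      ∃ f : Form Var → Prop, IsValuation f ∧ (∀ γ ∈ S, f γ) ∧ ¬ f β := by
    by_contra! H
    let L : List (Form Var) := S.toList.map Subtype.val
    have hL : L.foldr Form.imp β ∈ Γ := taut _ fun f hf =>
      (hf.foldr_imp L β).2 fun h => H f hf fun γ hγ =>
        h γ (List.mem_map_of_mem (Finset.mem_toList.2 hγ))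
    have hΓ : ∀ γ ∈ L, γ ∈ Γ := by simp +contextual [L]
    clear_value L
    induction L with
    | nil => exact hβ hL
    | cons γ L ih =>
      simp only [List.mem_cons, forall_eq_or_imp] at hΓ
      exact ih (mp _ _ hL hΓ.1) hΓ.2
  choose F hF hΓ hFβ using fin
  -- Compactness: the limit along an ultrafilter of the valuations `F S` is again a valuation, and
  -- each member of `Γ` is eventually in `S`.
  let U : Ultrafilter (Finset Γ) := Ultrafilter.of atTop
  refine ⟨fun φ => ∀ᶠ S in (U : Filter (Finset Γ)), F S φ, ⟨fun φ => ?_, fun φ ψ => ?_⟩,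
    fun φ hφ => ?_, ?_⟩
  · simp only [(hF _).neg, Ultrafilter.eventually_not]
  · simp only [(hF _).and, eventually_and]
  · have : ∀ᶠ S in (atTop : Filter (Finset Γ)), F S φ :=
      (eventually_ge_atTop {⟨φ, hφ⟩}).mono fun S hS =>
        hΓ S ⟨φ, hφ⟩ (Finset.singleton_subset_iff.1 hS)
    exact this.filter_mono (Ultrafilter.of_le _)
  · simp [hFβ, U.neBot.ne]

/-! ### Canonical valuations -/

/-- A Boolean valuation under which all theorems of the Yalcin logic are true. -/
structure IsCanonical (f : Form Var → Prop) : Prop extends IsValuation f where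
  thm (φ : Form Var) : YalcinLogic φ → f φ

theorem yalcinLogic_iff_forall_isCanonical {φ : Form Var} :
    YalcinLogic φ ↔ ∀ f : Form Var → Prop, IsCanonical f → f φ := by
  refine ⟨fun h f hf => hf.thm φ h, fun h => ?_⟩
  by_contra hφ
  obtain ⟨f, hf, hΓ, hfφ⟩ := exists_isValuation_of_notMem (Γ := {φ | YalcinLogic φ})
    (fun _ => .of_forall_isValuation) (fun _ _ => .mp) hφ
  exact hfφ (h f ⟨hf, hΓ⟩)

/-- Replace `α` by the equivalent `α ∧ β` in the consequent and split with I2. -/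
theorem YalcinLogic.cond_mono (φ : Form Var) {α β : Form Var} (h : YalcinLogic (α.imp β)) :
    YalcinLogic ((φ.cond α).imp (φ.cond β)) := by
  have h₁ : YalcinLogic (α.iff (α.and β)) :=
    yalcinLogic_iff_forall_isCanonical.2 fun f hf => by
      have := (hf.imp _ _).1 (hf.thm _ h)
      rw [hf.iff, hf.and]
      tauto
  have h₂ := YalcinLogic.repl h₁ (.cond_right φ .here)
  refine yalcinLogic_iff_forall_isCanonical.2 fun f hf => ?_
  have h₃ := (hf.iff _ _).1 (hf.thm _ h₂)
  have h₄ := (hf.iff _ _).1 (hf.thm _ (.axI2 φ α β))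
  rw [hf.and] at h₄
  rw [hf.imp]
  tauto

/-- I1 gives the case of a nonmodal tautology, which needs a variable to exist; monotonicity gives
the rest. -/
theorem YalcinLogic.cond_nec [Nonempty Var] (φ : Form Var) {α : Form Var} (h : YalcinLogic α) :
    YalcinLogic (φ.cond α) := by
  obtain ⟨p⟩ := ‹Nonempty Var›
  let t : Form Var := (Form.var p).imp (Form.var p)
  have h₁ : YalcinLogic (φ.imp t) := .of_forall_isValuation fun f hf => by
    simp only [t, hf.imp]; tauto
  have h₂ : YalcinLogic (t.imp α) := yalcinLogic_iff_forall_isCanonical.2 fun f hf =>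
    (hf.imp _ _).2 fun _ => hf.thm _ h
  refine .mp (.cond_mono φ h₂) (yalcinLogic_iff_forall_isCanonical.2 fun f hf => ?_)
  exact ((hf.iff _ _).1 (hf.thm _ (.axI1 φ t ⟨trivial, trivial⟩))).2 (hf.thm _ (.nec h₁))

namespace IsCanonical

variable {f : Form Var → Prop}

/-- Lindenbaum's lemma applies to `{α | f α.box}`, by necessitation and K. -/
theorem box_iff (hf : IsCanonical f) (β : Form Var) :
    f β.box ↔ ∀ g, IsCanonical g → (∀ α, f α.box → g α) → g β := by
  refine ⟨fun h g _ hg => hg β h, fun h => ?_⟩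
  by_contra hβ
  obtain ⟨g, hg, hΓ, hgβ⟩ := exists_isValuation_of_notMem (Γ := {α | f α.box})
    (fun _ h => hf.thm _ (.nec (.of_forall_isValuation h)))
    (fun φ ψ h => (hf.imp _ _).1 ((hf.imp _ _).1 (hf.thm _ (.axK φ ψ)) h)) hβ
  exact hgβ (h g ⟨hg, fun φ hφ => hΓ φ (hf.thm _ (.nec hφ))⟩ hΓ)

theorem cond_iff [Nonempty Var] (hf : IsCanonical f) (φ β : Form Var) :
    f (φ.cond β) ↔ ∀ g, IsCanonical g → (∀ α, f (φ.cond α) → g α) → g β := by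
  refine ⟨fun h g _ hg => hg β h, fun h => ?_⟩
  by_contra hβ
  obtain ⟨g, hg, hΓ, hgβ⟩ := exists_isValuation_of_notMem (Γ := {α | f (φ.cond α)})
    (fun _ h => hf.thm _ (.cond_nec φ (.of_forall_isValuation h)))
    (fun α β h h' => by
      have h₁ : YalcinLogic (((α.imp β).and α).imp β) := .of_forall_isValuation fun f hf => by
        simp only [hf.imp, hf.and]; tauto
      refine (hf.imp _ _).1 (hf.thm _ (.cond_mono φ h₁)) ?_
      exact ((hf.iff _ _).1 (hf.thm _ (.axI2 φ _ _))).2 ((hf.and _ _).2 ⟨h, h'⟩)) hβ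
  exact hgβ (h g ⟨hg, fun α hα => hΓ α (hf.thm _ (.cond_nec φ hα))⟩ hΓ)

theorem box_mono (hf : IsCanonical f) {α β : Form Var}
    (h : ∀ g, IsCanonical g → g α → g β) (hα : f α.box) : f β.box :=
  (hf.box_iff β).2 fun g hg hfg => h g hg (hfg α hα)

theorem exists_of_dia (hf : IsCanonical f) {β : Form Var} (h : f β.dia) :
    ∃ g, IsCanonical g ∧ (∀ α, f α.box → g α) ∧ g β := by
  rw [hf.dia, hf.box_iff] at h
  push Not at h
  obtain ⟨g, hg, hfg, hβ⟩ := h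
  rw [hg.neg, not_not] at hβ
  exact ⟨g, hg, hfg, hβ⟩

theorem box_box (hf : IsCanonical f) {α : Form Var} (h : f α.box) : f α.box.box := by
  have h₄ := (hf.imp _ _).1 (hf.thm _ (.ax4 α.neg))
  by_contra hn
  refine (hf.dia _).1 (h₄ ((hf.dia _).2 fun h' => hn ?_)) (hf.box_mono ?_ h)
  · refine hf.box_mono (fun g hg hgα => ?_) h'
    rw [hg.neg, hg.dia, not_not] at hgα
    exact hg.box_mono (fun k hk => by simp [hk.neg]) hgα
  · exact fun k hk => by simp [hk.neg]

/-- Boxed formulas keep their truth value along the canonical accessibility relation. -/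
theorem box_congr (hf : IsCanonical f) {g : Form Var → Prop} (hg : IsCanonical g)
    (hfg : ∀ α, f α.box → g α) (α : Form Var) : g α.box ↔ f α.box := by
  refine ⟨fun h => ?_, fun h => hfg _ (hf.box_box h)⟩
  refine (hf.imp _ _).1 (hf.thm _ (.ax5 α)) ((hf.dia _).2 fun h' => ?_)
  exact (hg.neg _).1 (hfg _ h') h

end IsCanonical

/-! ### Worlds over finitely many variables -/

section Finite

variable {n : ℕ} (l : Fin n → Var)

/-- The model whose worlds are the assignments to a finite family of variables. -/
def finModel : Model.{u, w} Var where
  W := ULift.{w} (Set (Fin n))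
  nonempty := ⟨⟨∅⟩⟩
  V p := {x | ∃ i, l i = p ∧ i ∈ x.down}

/-- The world of `finModel` described by a valuation. -/
def worldOf (f : Form Var → Prop) : (finModel.{u, w} l).W := ⟨{i | f (.var (l i))}⟩

theorem exists_state_description [Nonempty Var] (x : (finModel.{u, w} l).W) :
    ∃ δ : Form Var, δ.Nonmodal ∧
      ∀ f : Form Var → Prop, IsValuation f → (f δ ↔ worldOf l f = x) := by
  classical
  obtain ⟨s⟩ := x
  have key : ∀ L : List (Fin n), ∃ δ : Form Var, δ.Nonmodal ∧
      ∀ f : Form Var → Prop, IsValuation f →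
        (f δ ↔ ∀ i ∈ L, f (.var (l i)) ↔ i ∈ s) := by
    intro L
    induction L with
    | nil =>
      obtain ⟨p⟩ := ‹Nonempty Var›
      exact ⟨(Form.var p).imp (Form.var p), ⟨trivial, trivial⟩, fun f hf => by simp [hf.imp]⟩
    | cons i L ih =>
      obtain ⟨δ, hδ, h⟩ := ih
      by_cases hi : i ∈ s
      · exact ⟨(Form.var (l i)).and δ, ⟨trivial, hδ⟩, fun f hf => by simp [hf.and, h f hf, hi]⟩
      · exact ⟨(Form.var (l i)).neg.and δ, ⟨trivial, hδ⟩, fun f hf => by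
          simp [hf.and, hf.neg, h f hf, hi]⟩
  obtain ⟨δ, hδ, h⟩ := key (List.finRange n)
  refine ⟨δ, hδ, fun f hf => (h f hf).trans ?_⟩
  refine Iff.trans ?_ (ULift.up_inj (x := {i | f (.var (l i))}) (y := s)).symm
  simp [Set.ext_iff]

/-- The formula describing a world of `finModel`. -/
noncomputable def description [Nonempty Var] (x : (finModel.{u, w} l).W) : Form Var :=
  (exists_state_description l x).choose

variable [Nonempty Var]

theorem nonmodal_description (x : (finModel.{u, w} l).W) : (description l x).Nonmodal :=
  (exists_state_description l x).choose_spec.1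

theorem IsValuation.description_iff {f : Form Var → Prop} (hf : IsValuation f)
    (x : (finModel.{u, w} l).W) : f (description l x) ↔ worldOf l f = x :=
  (exists_state_description l x).choose_spec.2 f hf

/-- The information state described by a valuation. -/
def stateOf (f : Form Var → Prop) : Set (finModel.{u, w} l).W := {x | f (description l x).dia}

variable {l} {f g : Form Var → Prop}

theorem mem_stateOf (hf : IsCanonical f) {x : (finModel.{u, w} l).W} :
    x ∈ stateOf l f ↔ ∃ g, IsCanonical g ∧ (∀ α, f α.box → g α) ∧ worldOf l g = x := by
  constructor
  · intro h
    obtain ⟨g, hg, hfg, hx⟩ := hf.exists_of_dia h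
    exact ⟨g, hg, hfg, (hg.description_iff l x).1 hx⟩
  · rintro ⟨g, hg, hfg, hx⟩
    exact (hf.dia _).2 fun h => (hg.neg _).1 (hfg _ h) ((hg.description_iff l x).2 hx)

theorem stateOf_congr (hf : IsCanonical f) (hg : IsCanonical g) (hfg : ∀ α, f α.box → g α) :
    stateOf.{u, w} l g = stateOf l f := by
  ext x
  exact ((hg.dia _).trans (not_congr (hf.box_congr hg hfg _))).trans (hf.dia _).symm

/-- Descriptions are nonmodal, so I1 reduces the conditional to a box. -/
theorem mem_stateOf_cond {φ : Form Var} (hf : IsCanonical f) (x : (finModel.{u, w} l).W) :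
    ¬ f (φ.cond (description l x).neg) ↔
      ∃ g, IsCanonical g ∧ (∀ α, f α.box → g α) ∧ g φ ∧ worldOf l g = x := by
  have h := (hf.iff _ _).1 (hf.thm _ (.axI1 φ (description l x).neg (nonmodal_description l x)))
  rw [h, hf.box_iff]
  push Not
  refine exists_congr fun g => and_congr_right fun hg => and_congr_right fun _ => ?_
  rw [hg.imp, hg.neg, hg.description_iff]
  tauto

/-- Supposing `φ` restricts the described information state to the worlds where `φ` holds. -/
theorem stateOf_cond {φ : Form Var} (hf : IsCanonical f) (hg : IsCanonical g)
    (hfg : ∀ α, f (φ.cond α) → g α) :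
    stateOf.{u, w} l g = {x | ¬ f (φ.cond (description l x).neg)} := by
  ext x
  refine (hg.dia _).trans (not_congr ⟨fun h => ?_, fun h => ?_⟩)
  · by_contra hn
    -- I7 keeps surviving worlds possible for `g`; in the other direction, I4 excludes the
    -- eliminated ones.
    have h₇ := hfg _ ((hf.imp _ _).1 (hf.thm _ (.axI7 φ _)) ((hf.neg _).2 hn))
    exact (hg.dia _).1 h₇ (hg.box_mono (fun k hk => by simp [hk.neg]) h)
  · exact hfg _ ((hf.imp _ _).1 (hf.thm _ (.axI4 φ _)) h)

end Finite

/-! ### Truth lemma and completeness -/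

/-- The propositional variables of a formula. -/
def Form.vars : Form Var → List Var
  | var p => [p]
  | neg φ => vars φ
  | and φ ψ => vars φ ++ vars ψ
  | box φ => vars φ
  | cond φ ψ => vars φ ++ vars ψ

theorem sat_finModel_iff [Nonempty Var] {n : ℕ} (l : Fin n → Var) (φ : Form Var)
    (hφ : ∀ p ∈ φ.vars, ∃ i, l i = p) {f : Form Var → Prop} (hf : IsCanonical f) :
    Sat (finModel.{u, w} l) (worldOf l f) (stateOf l f) φ ↔ f φ := by
  induction φ generalizing f with
  | var p =>
    obtain ⟨i, rfl⟩ := hφ p (by simp [Form.vars])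
    constructor
    · rintro ⟨j, hj, h⟩
      exact hj ▸ h
    · exact fun h => ⟨i, rfl, h⟩
  | neg φ ih => rw [sat_neg, hf.neg, ih hφ hf]
  | and φ ψ ih ih' =>
    simp only [Form.vars, List.mem_append] at hφ
    rw [sat_and, hf.and, ih (fun p hp => hφ p (Or.inl hp)) hf,
      ih' (fun p hp => hφ p (Or.inr hp)) hf]
  | box φ ih =>
    rw [sat_box, hf.box_iff]
    constructor
    · intro h g hg hfg
      have := h _ ((mem_stateOf hf).2 ⟨g, hg, hfg, rfl⟩)
      rwa [← stateOf_congr hf hg hfg, ih hφ hg] at this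
    · intro h x hx
      obtain ⟨g, hg, hfg, rfl⟩ := (mem_stateOf hf).1 hx
      rw [← stateOf_congr hf hg hfg, ih hφ hg]
      exact h g hg hfg
  | cond φ ψ ih ih' =>
    simp only [Form.vars, List.mem_append] at hφ
    replace ih := @ih fun p hp => hφ p (Or.inl hp)
    replace ih' := @ih' fun p hp => hφ p (Or.inr hp)
    have hY : {x | x ∈ stateOf l f ∧ Sat (finModel.{u, w} l) x (stateOf l f) φ} =
        {x | ¬ f (φ.cond (description l x).neg)} := by
      ext x
      rw [Set.mem_ofPred_eq, Set.mem_ofPred_eq, mem_stateOf_cond hf]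
      constructor
      · rintro ⟨hx, hs⟩
        obtain ⟨g, hg, hfg, rfl⟩ := (mem_stateOf hf).1 hx
        rw [← stateOf_congr hf hg hfg, ih hg] at hs
        exact ⟨g, hg, hfg, hs, rfl⟩
      · rintro ⟨g, hg, hfg, hs, rfl⟩
        refine ⟨(mem_stateOf hf).2 ⟨g, hg, hfg, rfl⟩, ?_⟩
        rwa [← stateOf_congr hf hg hfg, ih hg]
    rw [sat_cond, hY, hf.cond_iff]
    constructor
    · intro h g hg hfg
      -- The world of `g` survives: otherwise `g` would refute its own description.
      have hx := h (worldOf l g) fun hn =>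
        (hg.neg _).1 (hfg _ hn) ((hg.description_iff l _).2 rfl)
      rwa [← stateOf_cond hf hg hfg, ih' hg] at hx
    · intro h x hx
      rw [Set.mem_ofPred_eq, hf.cond_iff] at hx
      push Not at hx
      obtain ⟨g, hg, hfg, hgx⟩ := hx
      rw [hg.neg, not_not, hg.description_iff] at hgx
      subst hgx
      rw [← stateOf_cond hf hg hfg, ih' hg]
      exact h g hg hfg

theorem Form.nonempty_var (φ : Form Var) : Nonempty Var := by
  induction φ with
  | var p => exact ⟨p⟩
  | _ => assumption

theorem yalcinLogic_of_valid {φ : Form Var} (h : Valid.{u, w} φ) : YalcinLogic φ := by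
  have := φ.nonempty_var
  refine yalcinLogic_iff_forall_isCanonical.2 fun f hf => ?_
  exact (sat_finModel_iff.{u, w} φ.vars.get φ (fun p hp => List.mem_iff_get.1 hp) hf).1 (h _ _ _)

theorem valid_iff_yalcinLogic {φ : Form Var} : Valid.{u, w} φ ↔ YalcinLogic φ :=
  ⟨yalcinLogic_of_valid, YalcinLogic.valid⟩

/-! ### Informational consequence -/

theorem sat_conjBoxes (M : Model.{u, w} Var) (x : M.W) (X : Set M.W) (σ : Form Var)
    (l : List (Form Var)) :
    Sat M x X (Form.conjBoxes σ l) ↔ ∀ τ ∈ σ :: l, Accepts M X τ := by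
  induction l generalizing σ with
  | nil => simp [Form.conjBoxes, sat_box, Accepts]
  | cons τ l ih =>
    rw [List.forall_mem_cons, ← ih τ]
    rfl

theorem sat_boxedImp (M : Model.{u, w} Var) (x : M.W) (X : Set M.W) (σs : List (Form Var))
    (φ : Form Var) :
    Sat M x X (Form.boxedImp σs φ) ↔ ((∀ σ ∈ σs, Accepts M X σ) → Accepts M X φ) := by
  cases σs with
  | nil => simp [Form.boxedImp, sat_box, Accepts]
  | cons σ l =>
    rw [Form.boxedImp, sat_imp, sat_conjBoxes]
    rfl

theorem infConsequence_iff_valid (σs : List (Form Var)) (φ : Form Var) :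
    InfConsequence.{u, w} {σ | σ ∈ σs} φ ↔ Valid.{u, w} (Form.boxedImp σs φ) :=
  ⟨fun h M x X => (sat_boxedImp M x X σs φ).2 (h M X),
    -- Any world will do, since boxed formulas depend only on the state; `X` itself may be empty.
    fun h M X => (sat_boxedImp M M.nonempty.some X σs φ).1 (h M _ X)⟩

end Yalcin

theorem theorem1 (Var : Type u) :
    {φ : Yalcin.Form Var | Yalcin.Valid.{u, w} φ} =
      {φ : Yalcin.Form Var | Yalcin.YalcinLogic φ} ∧
    ∀ (σs : List (Yalcin.Form Var)) (φ : Yalcin.Form Var),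
      Yalcin.InfConsequence.{u, w} {σ | σ ∈ σs} φ ↔
        Yalcin.YalcinLogic (Yalcin.Form.boxedImp σs φ) :=
  ⟨Set.ext fun _ => Yalcin.valid_iff_yalcinLogic, fun σs φ =>
    (Yalcin.infConsequence_iff_valid σs φ).trans Yalcin.valid_iff_yalcinLogic⟩
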